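/- Let $n>p$ be natural numbers, $0<\varepsilon<1$, $\delta>0$ and $\sigma\in\mathbb R$. A data set is a real $n\times p$ matrix $X=(x_{ij})$ with $|x_{ij}|\le 1$ for all $i,j$; two data sets $X,X'$ are neighbours if they differ in at most one row and $\|X-X'\|\le 1$, where $\|\cdot\|$ is the Frobenius ($L_2$) norm. Let $A$ be uniformly (Haar) distributed on the group of $n\times n$ orthogonal matrices and let $C$ be an $n\times p$ matrix, independent of $A$, with i.i.d. $N(0,\sigma^2)$ entries. Consider the two release mechanisms (B) $Y(X)=A(X+C)$, and (C) $Y(X)=AX+C$. Let $\gamma_{\delta,np}$ be the upper $\delta$-quantile of the (central) $\chi^2$ distribution with $np$ degrees of freedom, i.e. the least $t\ge 0$ with $P[\chi^2_{np}>t]\le\delta$. If $$\sigma^2\ \ge\ \max\Bigl(2,\ \frac{4np^2}{(n-p)\varepsilon},\ \frac{4p\,\gamma_{\delta,np}}{(n-p)\varepsilon}\Bigr),$$ then under each of (B) and (C) the following holds: for every data set $X$ the law of $Y(X)$ is absolutely continuous with respect to Lebesgue measure on $\mathbb R^{n\times p}$, with density denoted by $p_{Y(X)}$, and for every pair of neighbouring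 data sets $X,X'$, $$P\bigl[\,Y(X)\in\{y:\ p_{Y(X)}(y)>e^{\varepsilon}\,p_{Y(X')}(y)\}\,\bigr]\le\delta .$$ -/

import Mathlib

open MeasureTheory ProbabilityTheory
open scoped NNReal ENNReal

noncomputable section

namespace MatrixMasking

/-- Real `n × p` matrices carry the product measurable structure and `np`-dimensional
Lebesgue measure. -/
instance instMeasureSpaceMatrix (n p : ℕ) : MeasureSpace (Matrix (Fin n) (Fin p) ℝ) :=
  inferInstanceAs (MeasureSpace (Fin n → Fin p → ℝ))

instance instBorelSpaceMatrix (n p : ℕ) : BorelSpace (Matrix (Fin n) (Fin p) ℝ) :=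
  inferInstanceAs (BorelSpace (Fin n → Fin p → ℝ))

/-- The group `O(n)` of `n × n` real orthogonal matrices. -/
abbrev OrthGroup (n : ℕ) : Type := Matrix.orthogonalGroup (Fin n) ℝ

/-- The Borel structure on `O(n)`, as a subspace of the `n × n` matrices. -/
instance instMeasurableSpaceOrthGroup (n : ℕ) : MeasurableSpace (OrthGroup n) :=
  inferInstanceAs (MeasurableSpace (Subtype _))

instance instBorelSpaceOrthGroup (n : ℕ) : BorelSpace (OrthGroup n) :=
  inferInstanceAs (BorelSpace (Subtype _))

instance instCompactSpaceOrthGroup (n : ℕ) : CompactSpace (OrthGroup n) := by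
  apply isCompact_iff_compactSpace.mp
  have hK : IsCompact (Set.univ.pi fun _ : Fin n => Set.univ.pi fun _ : Fin n =>
      Set.Icc (-1 : ℝ) 1) :=
    isCompact_univ_pi fun _ => isCompact_univ_pi fun _ => isCompact_Icc
  have hc : IsClosed {A : Matrix (Fin n) (Fin n) ℝ | A ∈ Matrix.orthogonalGroup (Fin n) ℝ} := by
    have : {A : Matrix (Fin n) (Fin n) ℝ | A ∈ Matrix.orthogonalGroup (Fin n) ℝ}
        = {A : Matrix (Fin n) (Fin n) ℝ | A * star A = 1} := by
      ext A
      exact Matrix.mem_orthogonalGroup_iff (Fin n) ℝ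
    rw [this]
    exact isClosed_eq (by fun_prop) continuous_const
  refine IsCompact.of_isClosed_subset hK hc ?_
  intro A hA i _ j _
  have h := entry_norm_bound_of_unitary (𝕜 := ℝ) hA i j
  rw [Real.norm_eq_abs] at h
  exact abs_le.mp h

/-- The uniform distribution on the orthogonal group: Haar measure of total mass one. -/
def uniformOrth (n : ℕ) : Measure (OrthGroup n) := Measure.haarMeasure ⊤

/-- The law of an `n × p` matrix with i.i.d. `N(0, σ²)` entries. -/
def gaussianMatrix (n p : ℕ) (σ : ℝ) : Measure (Matrix (Fin n) (Fin p) ℝ) :=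
  Measure.pi fun _ : Fin n => Measure.pi fun _ : Fin p => gaussianReal 0 ⟨σ ^ 2, sq_nonneg σ⟩

/-- Setting (B), add noise and then mask: the law of `Y(X) = A (X + C)`, where `A` is uniform on
`O(n)`, `C` has i.i.d. `N(0, σ²)` entries, and `A` and `C` are independent. -/
def lawB (n p : ℕ) (σ : ℝ) (X : Matrix (Fin n) (Fin p) ℝ) : Measure (Matrix (Fin n) (Fin p) ℝ) :=
  ((uniformOrth n).prod (gaussianMatrix n p σ)).map
    fun ω => (ω.1 : Matrix (Fin n) (Fin n) ℝ) * (X + ω.2)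

/-- Setting (C), mask and then add noise: the law of `Y(X) = A X + C`, with `A` and `C` as in
setting (B). -/
def lawC (n p : ℕ) (σ : ℝ) (X : Matrix (Fin n) (Fin p) ℝ) : Measure (Matrix (Fin n) (Fin p) ℝ) :=
  ((uniformOrth n).prod (gaussianMatrix n p σ)).map
    fun ω => (ω.1 : Matrix (Fin n) (Fin n) ℝ) * X + ω.2

/-- The `L²` (Frobenius) norm of a matrix. -/
def l2Norm {n p : ℕ} (X : Matrix (Fin n) (Fin p) ℝ) : ℝ := √(∑ i, ∑ j, X i j ^ 2)

/-- A raw data set: all entries have magnitude at most one. -/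
def IsData {n p : ℕ} (X : Matrix (Fin n) (Fin p) ℝ) : Prop := ∀ i j, |X i j| ≤ 1

/-- Neighbouring data sets: they agree outside one row, and their `L²` distance is at most one. -/
def Neighbors {n p : ℕ} (X X' : Matrix (Fin n) (Fin p) ℝ) : Prop :=
  (∃ i, ∀ k, k ≠ i → ∀ j, X k j = X' k j) ∧ l2Norm (X - X') ≤ 1

/-- The probability density of a law on matrices, with respect to Lebesgue measure (it is
determined up to a Lebesgue null set). -/
def density {n p : ℕ} (μ : Measure (Matrix (Fin n) (Fin p) ℝ)) :
    Matrix (Fin n) (Fin p) ℝ → ℝ≥0∞ :=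
  μ.rnDeriv volume

/-- The set `{y : p_{Y(X)}(y) > e^ε p_{Y(X')}(y)}`, where `μ` and `μ'` are the laws of `Y(X)` and
`Y(X')`. -/
def densitySet {n p : ℕ} (ε : ℝ) (μ μ' : Measure (Matrix (Fin n) (Fin p) ℝ)) :
    Set (Matrix (Fin n) (Fin p) ℝ) :=
  {y | ENNReal.ofReal (Real.exp ε) * density μ' y < density μ y}

/-- The density-set condition for the mechanism `X ↦ Y(X)` with laws `law X`: each `Y(X)` is
absolutely continuous, so that its density exists, and
`P[Y(X) ∈ {y : p_{Y(X)}(y) > e^ε p_{Y(X')}(y)}] ≤ δ` for all neighbouring data sets `X`, `X'`. -/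
def DensitySetCondition {n p : ℕ}
    (law : Matrix (Fin n) (Fin p) ℝ → Measure (Matrix (Fin n) (Fin p) ℝ)) (ε δ : ℝ) : Prop :=
  (∀ X, IsData X → law X ≪ volume) ∧
  ∀ X X', IsData X → IsData X' → Neighbors X X' →
    law X (densitySet ε (law X) (law X')) ≤ ENNReal.ofReal δ

/-- The (central) `χ²` distribution with `k` degrees of freedom: the law of the sum of the squares
of `k` independent standard Gaussian variables. -/
def chiSquare (k : ℕ) : Measure ℝ :=
  (Measure.pi fun _ : Fin k => gaussianReal 0 1).map fun z => ∑ i, z i ^ 2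

/-- The upper `δ`-quantile of the `χ²` distribution with `k` degrees of freedom: the least `t ≥ 0`
with `P[χ²_k > t] ≤ δ`. -/
def chiSquareUpperQuantile (k : ℕ) (δ : ℝ) : ℝ :=
  sInf {t : ℝ | 0 ≤ t ∧ chiSquare k (Set.Ioi t) ≤ ENNReal.ofReal δ}

end MatrixMasking

end

namespace MatrixMasking

/-! Since `A C` has the law of `C` for every fixed orthogonal `A`, mechanisms (B) and (C) have the
same law (`lawB_eq_lawC`). Its density at `y` is a constant times `exp (-(‖y‖² + ‖X‖²) / (2σ²))`
times `I(X) = ∫ exp (⟨y, A X⟩ / σ²) dA` (`lawPDF_eq`).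

Neighbours share the matrix `M` obtained by zeroing the row where they may differ, so `X = M + e xᵀ`
with `e` a unit vector orthogonal to the columns of `M`. By Haar invariance, `e` may be replaced in
`I` by any other such unit vector. Let `f₁, …, f_m`, with `m ≥ n - p`, be an orthonormal basis of
the complement of the column space. Averaging over the vectors `m^(-1/2) ∑ ±f_j` turns the
contribution of the row into a product of hyperbolic cosines (`two_pow_mul_orthExpIntegral`). From
`1 ≤ cosh t ≤ exp (t²/2)` and Bessel's inequality, `I(M) ≤ I(X) ≤ exp (‖y‖²‖x‖² / (2σ⁴(n-p))) I(M)`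
(`orthExpIntegral_row_bounds`).

The density ratio is thus at most `e^ε` unless `‖y‖² > 2np + 2σ²γ` (`lawPDF_le_of_row`,
`exponent_le`), and that event has probability at most `δ` by the chi-square tail
(`lawB_sqNorm_gt_le`). -/

/-! ### Product densities and the Gaussian matrix density. -/

theorem lintegral_pi_prod {α : Type*} [MeasurableSpace α] (μ : Measure α) [SigmaFinite μ] {n : ℕ}
    (f : Fin n → α → ℝ≥0∞) (hf : ∀ i, Measurable (f i)) :
    ∫⁻ x, ∏ i, f i (x i) ∂(Measure.pi fun _ : Fin n => μ) = ∏ i, ∫⁻ x, f i x ∂μ := by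
  induction n with
  | zero => simp
  | succ n ih =>
    have hmp := (measurePreserving_piFinSuccAbove (fun _ : Fin (n + 1) => μ) 0).symm
    rw [← hmp.lintegral_comp (by fun_prop)]
    simp only [MeasurableEquiv.piFinSuccAbove_symm_apply, Fin.insertNthEquiv_apply,
      Fin.insertNth_zero', Fin.prod_univ_succ, Fin.cons_zero, Fin.cons_succ]
    have hf' : ∀ i : Fin n, Measurable (f i.succ) := fun i => hf _
    have hm : Measurable fun x : Fin n → α => ∏ i, f (Fin.succ i) (x i) := by fun_prop
    rw [lintegral_prod_mul (f := f 0) (g := fun x : Fin n → α => ∏ i, f (Fin.succ i) (x i))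
      (hf 0).aemeasurable hm.aemeasurable, ih _ fun i => hf _]

theorem pi_withDensity {α : Type*} [MeasurableSpace α] (μ : Measure α) [SigmaFinite μ] {n : ℕ}
    (f : α → ℝ≥0∞) (hf : Measurable f) [SigmaFinite (μ.withDensity f)] :
    (Measure.pi fun _ : Fin n => μ.withDensity f)
      = (Measure.pi fun _ : Fin n => μ).withDensity fun x => ∏ i, f (x i) := by
  refine Measure.pi_eq fun s hs => ?_
  rw [withDensity_apply _ (MeasurableSet.univ_pi hs),
    ← lintegral_indicator (MeasurableSet.univ_pi hs)]
  have h : (Set.univ.pi s).indicator (fun x : Fin n → α => ∏ i, f (x i))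
      = fun x => ∏ i, (s i).indicator f (x i) := by
    classical
    ext x
    by_cases hx : x ∈ Set.univ.pi s
    · rw [Set.indicator_of_mem hx]
      exact Finset.prod_congr rfl fun i _ => (Set.indicator_of_mem (hx i trivial) _).symm
    · rw [Set.indicator_of_notMem hx]
      obtain ⟨i, hi⟩ : ∃ i, x i ∉ s i := by simpa using hx
      exact (Finset.prod_eq_zero (Finset.mem_univ i) (Set.indicator_of_notMem hi _)).symm
  rw [h, lintegral_pi_prod μ _ fun i => hf.indicator (hs i)]
  refine Finset.prod_congr rfl fun i _ => ?_
  rw [withDensity_apply _ (hs i), lintegral_indicator (hs i)]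

/-- The squared Frobenius norm. -/
noncomputable def sqNorm {n p : ℕ} (X : Matrix (Fin n) (Fin p) ℝ) : ℝ := ∑ i, ∑ j, X i j ^ 2

/-- The Lebesgue density of a Gaussian matrix. -/
noncomputable def gaussianMatrixPDF {n p : ℕ} (σ : ℝ) (c : Matrix (Fin n) (Fin p) ℝ) : ℝ≥0∞ :=
  ENNReal.ofReal ((√(2 * Real.pi * σ ^ 2))⁻¹ ^ (n * p) * Real.exp (-sqNorm c / (2 * σ ^ 2)))

theorem gaussianMatrix_eq_pi (n p : ℕ) (σ : ℝ) :
    gaussianMatrix n p σ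
      = Measure.pi fun _ : Fin n => Measure.pi fun _ : Fin p => gaussianReal 0 (σ ^ 2).toNNReal := by
  rw [Real.toNNReal_of_nonneg (sq_nonneg σ)]
  rfl

theorem prod_gaussianPDF {n p : ℕ} (σ : ℝ) (c : Matrix (Fin n) (Fin p) ℝ) :
    ∏ i, ∏ j, gaussianPDF 0 (σ ^ 2).toNNReal (c i j) = gaussianMatrixPDF σ c := by
  have h0 : ∀ x, 0 ≤ gaussianPDFReal 0 (σ ^ 2).toNNReal x := gaussianPDFReal_nonneg _ _
  have h1 : ∏ i, ∏ j, gaussianPDF 0 (σ ^ 2).toNNReal (c i j)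
      = ENNReal.ofReal (∏ i, ∏ j, gaussianPDFReal 0 (σ ^ 2).toNNReal (c i j)) := by
    refine .trans (Finset.prod_congr rfl fun i _ => ?_)
      (ENNReal.ofReal_prod_of_nonneg fun i _ => Finset.prod_nonneg fun j _ => h0 (c i j)).symm
    exact (ENNReal.ofReal_prod_of_nonneg fun j _ => h0 (c i j)).symm
  rw [h1, gaussianMatrixPDF]
  congr 1
  simp only [gaussianPDFReal, Finset.prod_mul_distrib, Finset.prod_const, ← Real.exp_sum,
    Finset.card_univ, Fintype.card_fin, Real.coe_toNNReal _ (sq_nonneg σ), sub_zero]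
  rw [← pow_mul, mul_comm p n]
  simp only [← Finset.sum_div, Finset.sum_neg_distrib, sqNorm]

theorem measurable_sqNorm {n p : ℕ} :
    Measurable (sqNorm : Matrix (Fin n) (Fin p) ℝ → ℝ) := by
  have : Continuous (sqNorm : Matrix (Fin n) (Fin p) ℝ → ℝ) := by unfold sqNorm; fun_prop
  exact this.measurable

theorem measurable_gaussianMatrixPDF {n p : ℕ} (σ : ℝ) :
    Measurable (gaussianMatrixPDF σ : Matrix (Fin n) (Fin p) ℝ → ℝ≥0∞) := by
  have := measurable_sqNorm (n := n) (p := p)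
  unfold gaussianMatrixPDF
  fun_prop

theorem gaussianMatrix_eq_withDensity (n p : ℕ) {σ : ℝ} (hσ : σ ≠ 0) :
    gaussianMatrix n p σ = volume.withDensity (gaussianMatrixPDF σ) := by
  have hv : (σ ^ 2).toNNReal ≠ 0 := (Real.toNNReal_pos.2 (by positivity)).ne'
  have h1 : (Measure.pi fun _ : Fin p => gaussianReal 0 (σ ^ 2).toNNReal)
      = (Measure.pi fun _ : Fin p => (volume : Measure ℝ)).withDensity
        fun x => ∏ j, gaussianPDF 0 (σ ^ 2).toNNReal (x j) := by
    have h := gaussianReal_of_var_ne_zero 0 hv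
    rw [h]
    have : SigmaFinite ((volume : Measure ℝ).withDensity
        (gaussianPDF 0 (σ ^ 2).toNNReal)) := by rw [← h]; infer_instance
    exact pi_withDensity _ _ (measurable_gaussianPDF _ _)
  have hs : SigmaFinite ((Measure.pi fun _ : Fin p => (volume : Measure ℝ)).withDensity
        fun x => ∏ j, gaussianPDF 0 (σ ^ 2).toNNReal (x j)) := by
    rw [← h1]; infer_instance
  rw [gaussianMatrix_eq_pi, h1, pi_withDensity _ _ (by
    have := measurable_gaussianPDF 0 ((σ ^ 2).toNNReal)
    fun_prop)]
  rw [← show (fun c : Matrix (Fin n) (Fin p) ℝ => ∏ i, ∏ j, gaussianPDF 0 (σ ^ 2).toNNReal (c i j))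
    = gaussianMatrixPDF σ from funext fun c => prod_gaussianPDF σ c]
  rfl

/-! ### Invariant measures on matrices and on the orthogonal group. -/

instance instIsAddHaarMeasureMatrix (n p : ℕ) :
    (volume : Measure (Matrix (Fin n) (Fin p) ℝ)).IsAddHaarMeasure := by
  have : (volume : Measure (Fin p → ℝ)).IsAddHaarMeasure := inferInstance
  exact inferInstanceAs (Measure.pi fun _ : Fin n => (volume : Measure (Fin p → ℝ))).IsAddHaarMeasure

instance instSigmaFiniteMatrix (n p : ℕ) :
    SigmaFinite (volume : Measure (Matrix (Fin n) (Fin p) ℝ)) :=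
  inferInstanceAs (SigmaFinite (Measure.pi fun _ : Fin n => Measure.pi fun _ : Fin p =>
    (volume : Measure ℝ)))

instance instSecondCountableOrthGroup (n : ℕ) : SecondCountableTopology (OrthGroup n) :=
  inferInstanceAs (SecondCountableTopology (Subtype fun A : Fin n → Fin n → ℝ =>
    (A : Matrix (Fin n) (Fin n) ℝ) ∈ Matrix.orthogonalGroup (Fin n) ℝ))

instance instSecondCountableMatrix (n p : ℕ) :
    SecondCountableTopology (Matrix (Fin n) (Fin p) ℝ) :=
  inferInstanceAs (SecondCountableTopology (Fin n → Fin p → ℝ))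

instance instLocallyCompactSpaceMatrix (n p : ℕ) :
    LocallyCompactSpace (Matrix (Fin n) (Fin p) ℝ) :=
  inferInstanceAs (LocallyCompactSpace (Fin n → Fin p → ℝ))

instance instIsProbabilityMeasureGaussianMatrix (n p : ℕ) (σ : ℝ) :
    IsProbabilityMeasure (gaussianMatrix n p σ) := by
  rw [gaussianMatrix_eq_pi]
  exact inferInstanceAs (IsProbabilityMeasure (Measure.pi fun _ : Fin n =>
    Measure.pi fun _ : Fin p => gaussianReal 0 (σ ^ 2).toNNReal))

instance instIsHaarMeasureUniformOrth (n : ℕ) : (uniformOrth n).IsHaarMeasure := by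
  unfold uniformOrth; infer_instance

instance instIsProbabilityMeasureUniformOrth (n : ℕ) : IsProbabilityMeasure (uniformOrth n) :=
  ⟨Measure.haarMeasure_self (K₀ := (⊤ : TopologicalSpace.PositiveCompacts (OrthGroup n)))⟩

/-- A right translate of a left Haar probability measure is again one, and such a measure is unique.
-/
instance instIsMulRightInvariantUniformOrth (n : ℕ) : (uniformOrth n).IsMulRightInvariant where
  map_mul_right_eq_self g := by
    have : IsProbabilityMeasure ((uniformOrth n).map (· * g)) :=
      Measure.isProbabilityMeasure_map (by fun_prop)
    exact Measure.isHaarMeasure_eq_of_isProbabilityMeasure _ _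

theorem sqNorm_eq_trace {n p : ℕ} (X : Matrix (Fin n) (Fin p) ℝ) :
    sqNorm X = (X.transpose * X).trace := by
  simp only [sqNorm, Matrix.trace, Matrix.diag, Matrix.mul_apply, Matrix.transpose_apply, ← sq]
  exact Finset.sum_comm

theorem OrthGroup.transpose_mul {n : ℕ} (A : OrthGroup n) :
    (A : Matrix (Fin n) (Fin n) ℝ).transpose * A = 1 :=
  (Matrix.mem_orthogonalGroup_iff' (Fin n) ℝ).1 A.2

theorem OrthGroup.mul_transpose {n : ℕ} (A : OrthGroup n) :
    (A : Matrix (Fin n) (Fin n) ℝ) * (A : Matrix (Fin n) (Fin n) ℝ).transpose = 1 :=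
  (Matrix.mem_orthogonalGroup_iff (Fin n) ℝ).1 A.2

theorem sqNorm_orth_mul {n p : ℕ} (A : OrthGroup n) (X : Matrix (Fin n) (Fin p) ℝ) :
    sqNorm ((A : Matrix (Fin n) (Fin n) ℝ) * X) = sqNorm X := by
  rw [sqNorm_eq_trace, sqNorm_eq_trace, Matrix.transpose_mul, Matrix.mul_assoc,
    ← Matrix.mul_assoc _ _ X, A.transpose_mul, Matrix.one_mul]

/-- The image measure is additive Haar, hence a multiple of Lebesgue measure. The standard Gaussian
density has integral one and depends only on the norm, which forces the factor to be one; no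
determinant is needed. -/
theorem map_orth_mul_volume (n p : ℕ) (A : OrthGroup n) :
    (volume : Measure (Matrix (Fin n) (Fin p) ℝ)).map
      (fun c => (A : Matrix (Fin n) (Fin n) ℝ) * c) = volume := by
  let L : Matrix (Fin n) (Fin p) ℝ ≃+ Matrix (Fin n) (Fin p) ℝ :=
    { toFun := fun c => (A : Matrix (Fin n) (Fin n) ℝ) * c
      invFun := fun c => (A : Matrix (Fin n) (Fin n) ℝ).transpose * c
      left_inv := fun c => by beta_reduce; rw [← Matrix.mul_assoc, A.transpose_mul, Matrix.one_mul]
      right_inv := fun c => by beta_reduce; rw [← Matrix.mul_assoc, A.mul_transpose, Matrix.one_mul]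
      map_add' := fun c d => Matrix.mul_add _ c d }
  have hL : Continuous L := by change Continuous fun c => (A : Matrix (Fin n) (Fin n) ℝ) * c; fun_prop
  have hL' : Continuous L.symm := by
    change Continuous fun c => (A : Matrix (Fin n) (Fin n) ℝ).transpose * c; fun_prop
  have hH := L.isAddHaarMeasure_map volume hL hL'
  have hk := Measure.isAddLeftInvariant_eq_smul (volume.map L) volume
  set k := Measure.addHaarScalarFactor (volume.map L) (volume : Measure (Matrix (Fin n) (Fin p) ℝ))
  have h1 : ∫⁻ c : Matrix (Fin n) (Fin p) ℝ, gaussianMatrixPDF 1 c = 1 := by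
    rw [← setLIntegral_univ, ← withDensity_apply _ MeasurableSet.univ,
      ← gaussianMatrix_eq_withDensity n p one_ne_zero, measure_univ]
  have h2 : ∫⁻ c : Matrix (Fin n) (Fin p) ℝ, gaussianMatrixPDF 1 c ∂(volume.map L) = 1 := by
    rw [lintegral_map (measurable_gaussianMatrixPDF 1) hL.measurable, ← h1]
    refine lintegral_congr fun c => ?_
    simp only [gaussianMatrixPDF]
    rw [show L c = (A : Matrix (Fin n) (Fin n) ℝ) * c from rfl, sqNorm_orth_mul]
  rw [hk, lintegral_smul_measure, h1, ENNReal.smul_def, smul_eq_mul, mul_one] at h2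
  change volume.map L = volume
  rw [hk, ENNReal.coe_eq_one.1 h2, one_smul]

theorem map_orth_mul_gaussianMatrix (n p : ℕ) {σ : ℝ} (hσ : σ ≠ 0) (A : OrthGroup n) :
    (gaussianMatrix n p σ).map (fun c => (A : Matrix (Fin n) (Fin n) ℝ) * c)
      = gaussianMatrix n p σ := by
  have hA : Measurable fun c : Matrix (Fin n) (Fin p) ℝ => (A : Matrix (Fin n) (Fin n) ℝ) * c := by
    have : Continuous fun c : Matrix (Fin n) (Fin p) ℝ => (A : Matrix (Fin n) (Fin n) ℝ) * c := by
      fun_prop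
    exact this.measurable
  rw [gaussianMatrix_eq_withDensity n p hσ]
  ext s hs
  have hG := measurable_gaussianMatrixPDF (n := n) (p := p) σ
  rw [Measure.map_apply hA hs, withDensity_apply _ (hA hs), withDensity_apply _ hs]
  conv_rhs => rw [← map_orth_mul_volume n p A, setLIntegral_map hs hG hA]
  simp only [gaussianMatrixPDF, sqNorm_orth_mul]

/-! ### The common law of the two mechanisms and its density. -/

theorem continuous_orth_mul {n p : ℕ} :
    Continuous fun z : OrthGroup n × Matrix (Fin n) (Fin p) ℝ =>
      (z.1 : Matrix (Fin n) (Fin n) ℝ) * z.2 := by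
  have : Continuous fun z : OrthGroup n × Matrix (Fin n) (Fin p) ℝ =>
      (z.1 : Matrix (Fin n) (Fin n) ℝ) := continuous_subtype_val.comp continuous_fst
  fun_prop

/-- The Lebesgue density of `A X + C`. -/
noncomputable def lawPDF {n p : ℕ} (σ : ℝ) (X y : Matrix (Fin n) (Fin p) ℝ) : ℝ≥0∞ :=
  ∫⁻ A : OrthGroup n, gaussianMatrixPDF σ (y - (A : Matrix (Fin n) (Fin n) ℝ) * X) ∂uniformOrth n

theorem measurable_sub_orth_mul {n p : ℕ} (X : Matrix (Fin n) (Fin p) ℝ) :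
    Measurable fun z : Matrix (Fin n) (Fin p) ℝ × OrthGroup n =>
      z.1 - (z.2 : Matrix (Fin n) (Fin n) ℝ) * X := by
  have h : Continuous fun z : Matrix (Fin n) (Fin p) ℝ × OrthGroup n =>
      (z.2 : Matrix (Fin n) (Fin n) ℝ) * X :=
    continuous_orth_mul.comp (continuous_snd.prodMk continuous_const)
  exact (continuous_fst.sub h).measurable

theorem measurable_lawPDF {n p : ℕ} (σ : ℝ) (X : Matrix (Fin n) (Fin p) ℝ) :
    Measurable (lawPDF σ X) :=
  ((measurable_gaussianMatrixPDF σ).comp (measurable_sub_orth_mul X)).lintegral_prod_right'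

theorem measurable_maskC {n p : ℕ} (X : Matrix (Fin n) (Fin p) ℝ) :
    Measurable fun ω : OrthGroup n × Matrix (Fin n) (Fin p) ℝ =>
      (ω.1 : Matrix (Fin n) (Fin n) ℝ) * X + ω.2 :=
  ((continuous_orth_mul.comp (continuous_fst.prodMk continuous_const)).add
    continuous_snd).measurable

theorem measurable_maskB {n p : ℕ} (X : Matrix (Fin n) (Fin p) ℝ) :
    Measurable fun ω : OrthGroup n × Matrix (Fin n) (Fin p) ℝ =>
      (ω.1 : Matrix (Fin n) (Fin n) ℝ) * (X + ω.2) :=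
  (continuous_orth_mul.comp
    (continuous_fst.prodMk (continuous_const.add continuous_snd))).measurable

/-- Tonelli reduces this to a fixed `A`, where the law is the Gaussian translated by `A X`. -/
theorem lawC_eq_withDensity (n p : ℕ) {σ : ℝ} (hσ : σ ≠ 0) (X : Matrix (Fin n) (Fin p) ℝ) :
    lawC n p σ X = volume.withDensity (lawPDF σ X) := by
  have hG := measurable_gaussianMatrixPDF (n := n) (p := p) σ
  ext s hs
  have hms := measurable_maskC X hs
  rw [lawC, Measure.map_apply (measurable_maskC X) hs, Measure.prod_apply hms,
    withDensity_apply _ hs]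
  unfold lawPDF
  rw [lintegral_lintegral_swap (f := fun y (A : OrthGroup n) =>
    gaussianMatrixPDF σ (y - (A : Matrix (Fin n) (Fin n) ℝ) * X))
    (hG.comp (measurable_sub_orth_mul X)).aemeasurable]
  refine lintegral_congr fun A => ?_
  rw [gaussianMatrix_eq_withDensity n p hσ, withDensity_apply _ (measurable_prodMk_left hms),
    ← lintegral_indicator (measurable_prodMk_left hms), ← lintegral_indicator hs]
  conv_rhs => rw [← lintegral_add_left_eq_self (μ := volume) _ ((A : Matrix (Fin n) (Fin n) ℝ) * X)]
  refine lintegral_congr fun c => ?_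
  simp only [Set.indicator, add_sub_cancel_left]
  rfl

theorem lawB_eq_lawC (n p : ℕ) {σ : ℝ} (hσ : σ ≠ 0) (X : Matrix (Fin n) (Fin p) ℝ) :
    lawB n p σ X = lawC n p σ X := by
  ext s hs
  have hms := measurable_maskC X hs
  rw [lawB, lawC, Measure.map_apply (measurable_maskB X) hs, Measure.map_apply (measurable_maskC X) hs,
    Measure.prod_apply (measurable_maskB X hs), Measure.prod_apply hms]
  refine lintegral_congr fun A => ?_
  have hA : Measurable fun c : Matrix (Fin n) (Fin p) ℝ => (A : Matrix (Fin n) (Fin n) ℝ) * c :=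
    (continuous_orth_mul.comp (continuous_const.prodMk continuous_id)).measurable
  conv_rhs => rw [← map_orth_mul_gaussianMatrix n p hσ A,
    Measure.map_apply hA (measurable_prodMk_left hms)]
  congr 1
  ext c
  simp only [Set.mem_preimage, Matrix.mul_add]

/-! ### Chi-square tails. -/

theorem map_gaussianMatrix_div (n p : ℕ) {σ : ℝ} (hσ : σ ≠ 0) :
    (gaussianMatrix n p σ).map
      (fun c (k : Fin (n * p)) => c (finProdFinEquiv.symm k).1 (finProdFinEquiv.symm k).2 / σ)
      = Measure.pi fun _ => gaussianReal 0 1 := by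
  refine (Measure.pi_eq fun s hs => ?_).symm
  have hm : Measurable fun (c : Matrix (Fin n) (Fin p) ℝ) (k : Fin (n * p)) =>
      c (finProdFinEquiv.symm k).1 (finProdFinEquiv.symm k).2 / σ := by
    have : Continuous fun (c : Matrix (Fin n) (Fin p) ℝ) (k : Fin (n * p)) =>
      c (finProdFinEquiv.symm k).1 (finProdFinEquiv.symm k).2 / σ := by fun_prop
    exact this.measurable
  have hpre : (fun (c : Matrix (Fin n) (Fin p) ℝ) (k : Fin (n * p)) =>
      c (finProdFinEquiv.symm k).1 (finProdFinEquiv.symm k).2 / σ) ⁻¹' Set.univ.pi s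
      = Set.univ.pi fun i => Set.univ.pi fun j =>
        (fun x : ℝ => x / σ) ⁻¹' s (finProdFinEquiv (i, j)) := by
    ext c
    simp only [Set.mem_preimage, Set.mem_univ_pi]
    constructor
    · intro h i _ j _
      simpa using h (finProdFinEquiv (i, j))
    · intro h k
      have hk := h (finProdFinEquiv.symm k).1 trivial (finProdFinEquiv.symm k).2 trivial
      rwa [Set.mem_preimage, Prod.mk.eta, Equiv.apply_symm_apply] at hk
  have hg : (gaussianReal 0 (σ ^ 2).toNNReal).map (fun x : ℝ => x / σ) = gaussianReal 0 1 := by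
    rw [gaussianReal_map_div_const, zero_div]
    congr 1
    ext
    simp [Real.coe_toNNReal _ (sq_nonneg σ), hσ]
  rw [Measure.map_apply hm (MeasurableSet.univ_pi hs), gaussianMatrix_eq_pi, hpre]
  erw [Measure.pi_pi]
  simp_rw [Measure.pi_pi]
  rw [← Fintype.prod_prod_type', ← finProdFinEquiv.prod_comp]
  refine Finset.prod_congr rfl fun k _ => ?_
  rw [← hg, Measure.map_apply (by fun_prop) (hs _)]

theorem gaussianMatrix_sqNorm_gt (n p : ℕ) {σ : ℝ} (hσ : σ ≠ 0) (t : ℝ) :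
    gaussianMatrix n p σ {c | σ ^ 2 * t < sqNorm c} = chiSquare (n * p) (Set.Ioi t) := by
  have hm : Measurable fun (c : Matrix (Fin n) (Fin p) ℝ) (k : Fin (n * p)) =>
      c (finProdFinEquiv.symm k).1 (finProdFinEquiv.symm k).2 / σ := by
    have : Continuous fun (c : Matrix (Fin n) (Fin p) ℝ) (k : Fin (n * p)) =>
      c (finProdFinEquiv.symm k).1 (finProdFinEquiv.symm k).2 / σ := by fun_prop
    exact this.measurable
  rw [chiSquare, Measure.map_apply (by fun_prop) measurableSet_Ioi, ← map_gaussianMatrix_div n p hσ,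
    Measure.map_apply hm (measurableSet_preimage (by fun_prop) measurableSet_Ioi)]
  congr 1
  ext c
  have hsum : ∑ k : Fin (n * p), (c (finProdFinEquiv.symm k).1 (finProdFinEquiv.symm k).2 / σ) ^ 2
      = sqNorm c / σ ^ 2 := by
    rw [← finProdFinEquiv.sum_comp]
    simp only [Equiv.symm_apply_apply, Fintype.sum_prod_type, div_pow, ← Finset.sum_div, sqNorm]
  simp only [Set.mem_ofPred_eq, Set.mem_preimage, Set.mem_Ioi, hsum]
  rw [lt_div_iff₀ (by positivity), mul_comm]

instance instIsProbabilityMeasureChiSquare (k : ℕ) : IsProbabilityMeasure (chiSquare k) :=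
  Measure.isProbabilityMeasure_map (by
    have : Measurable fun z : Fin k → ℝ => ∑ i, z i ^ 2 := by fun_prop
    exact this.aemeasurable)

theorem chiSquareUpperQuantile_nonneg (k : ℕ) (δ : ℝ) : 0 ≤ chiSquareUpperQuantile k δ :=
  Real.sInf_nonneg fun _ h => h.1

/-- The infimum is attained: the open ray at it is the increasing union of rays starting strictly to
its right, each of mass at most `δ`. Positivity of `δ` makes the defining set nonempty. -/
theorem chiSquare_Ioi_upperQuantile_le (k : ℕ) {δ : ℝ} (hδ : 0 < δ) :
    chiSquare k (Set.Ioi (chiSquareUpperQuantile k δ)) ≤ ENNReal.ofReal δ := by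
  set g := chiSquareUpperQuantile k δ with hg
  have hne : {t : ℝ | 0 ≤ t ∧ chiSquare k (Set.Ioi t) ≤ ENNReal.ofReal δ}.Nonempty := by
    have hlim : Filter.Tendsto (fun m : ℕ => chiSquare k (Set.Ioi (m : ℝ))) Filter.atTop
        (nhds (chiSquare k (⋂ m : ℕ, Set.Ioi (m : ℝ)))) :=
      tendsto_measure_iInter_atTop (fun _ => measurableSet_Ioi.nullMeasurableSet)
        (fun a b hab => Set.Ioi_subset_Ioi (by exact_mod_cast hab)) ⟨0, measure_ne_top _ _⟩
    have hempty : ⋂ m : ℕ, Set.Ioi (m : ℝ) = ∅ := by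
      ext x
      simpa using exists_nat_ge x
    rw [hempty, measure_empty] at hlim
    obtain ⟨m, hm⟩ := (hlim.eventually_le_const (ENNReal.ofReal_pos.2 hδ)).exists
    exact ⟨m, m.cast_nonneg, hm⟩
  have hU : Set.Ioi g = ⋃ m : ℕ, Set.Ioi (g + 1 / ((m : ℝ) + 1)) := by
    ext x
    simp only [Set.mem_Ioi, Set.mem_iUnion]
    constructor
    · intro h
      obtain ⟨m, hm⟩ := exists_nat_one_div_lt (sub_pos.2 h)
      exact ⟨m, by linarith⟩
    · rintro ⟨m, hm⟩
      have : (0 : ℝ) < 1 / ((m : ℝ) + 1) := by positivity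
      linarith
  have hmono : Monotone fun m : ℕ => Set.Ioi (g + 1 / ((m : ℝ) + 1)) := fun a b hab =>
    Set.Ioi_subset_Ioi (by gcongr)
  rw [hU, hmono.measure_iUnion]
  refine iSup_le fun m => ?_
  have hlt : g < g + 1 / ((m : ℝ) + 1) := by
    have : (0 : ℝ) < 1 / ((m : ℝ) + 1) := by positivity
    linarith
  obtain ⟨t, ht, htlt⟩ := exists_lt_of_csInf_lt hne hlt
  exact (measure_mono (Set.Ioi_subset_Ioi htlt.le)).trans ht.2

/-! ### Averaging over the orthogonal group. -/

-- The Householder reflection along `e - u` sends `e` to `u` because their lengths agree, and fixes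
-- the columns of `M` because they are orthogonal to `e - u`.
open Matrix in
theorem exists_orth_map_vector {n p : ℕ} (M : Matrix (Fin n) (Fin p) ℝ) (e u : Fin n → ℝ)
    (heu : e ⬝ᵥ e = u ⬝ᵥ u) (he : e ᵥ* M = 0) (hu : u ᵥ* M = 0) :
    ∃ Q : OrthGroup n, (Q : Matrix (Fin n) (Fin n) ℝ) * M = M ∧
      (Q : Matrix (Fin n) (Fin n) ℝ) *ᵥ e = u := by
  by_cases h : e = u
  · exact ⟨1, by simp, by simp [h]⟩
  set w := e - u with hw
  have hww : w ⬝ᵥ w ≠ 0 := fun h0 => h (sub_eq_zero.1 (dotProduct_self_eq_zero.1 h0))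
  have hwe : 2 * (w ⬝ᵥ e) = w ⬝ᵥ w := by
    simp only [hw, sub_dotProduct, dotProduct_sub, heu, dotProduct_comm u e]
    ring
  have hM : vecMulVec w w * M = 0 := by
    rw [vecMulVec_mul, hw, sub_vecMul, he, hu, sub_zero]
    ext
    simp [vecMulVec_apply]
  refine ⟨⟨1 - (2 / (w ⬝ᵥ w)) • vecMulVec w w, ?_⟩, ?_, ?_⟩
  · rw [mem_orthogonalGroup_iff]
    have hP : vecMulVec w w * vecMulVec w w = (w ⬝ᵥ w) • vecMulVec w w := by
      rw [vecMulVec_mul_vecMulVec, vecMulVec_smul]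
    rw [transpose_sub, transpose_smul,
      transpose_vecMulVec, transpose_one, mul_sub, sub_mul, sub_mul, mul_one, one_mul, mul_one,
      smul_mul_smul_comm, hP, smul_smul]
    rw [show 2 / (w ⬝ᵥ w) * (2 / (w ⬝ᵥ w)) * (w ⬝ᵥ w) = 2 / (w ⬝ᵥ w) + 2 / (w ⬝ᵥ w) by
      field_simp; ring, add_smul]
    abel
  · change (1 - (2 / (w ⬝ᵥ w)) • vecMulVec w w) * M = M
    rw [Matrix.sub_mul, smul_mul, hM, smul_zero, Matrix.one_mul, sub_zero]
  · change (1 - (2 / (w ⬝ᵥ w)) • vecMulVec w w) *ᵥ e = u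
    rw [sub_mulVec, smul_mulVec, vecMulVec_mulVec, one_mulVec]
    ext k
    simp only [Pi.sub_apply, Pi.smul_apply, smul_eq_mul, MulOpposite.smul_eq_mul_unop,
      MulOpposite.unop_op]
    have : 2 / (w ⬝ᵥ w) * (w k * (w ⬝ᵥ e)) = w k := by
      field_simp
      linear_combination w k * hwe
    rw [this, hw]
    simp

open Matrix in
theorem exists_orthonormal_vecMul_eq_zero {n p : ℕ} (M : Matrix (Fin n) (Fin p) ℝ) :
    ∃ (m : ℕ) (f : Fin m → Fin n → ℝ), n ≤ m + p ∧
      (∀ j k, f j ⬝ᵥ f k = if j = k then 1 else 0) ∧ (∀ j, f j ᵥ* M = 0) ∧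
      ∀ c : Fin n → ℝ, ∑ j, (f j ⬝ᵥ c) ^ 2 ≤ c ⬝ᵥ c := by
  -- The column space of `M` has dimension at most `p`; the `f j` form an orthonormal basis of its
  -- complement.
  let W : Submodule ℝ (EuclideanSpace ℝ (Fin n)) :=
    Submodule.span ℝ (Set.range fun k : Fin p => WithLp.toLp 2 (fun i => M i k))
  have hW : Module.finrank ℝ W ≤ p := by
    refine (finrank_range_le_card (R := ℝ)
      (fun k : Fin p => (WithLp.toLp 2 (fun i => M i k) : EuclideanSpace ℝ (Fin n)))).trans_eq (Fintype.card_fin p)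
  have hsum := W.finrank_add_finrank_orthogonal
  rw [finrank_euclideanSpace_fin] at hsum
  let b := stdOrthonormalBasis ℝ Wᗮ
  have hb : Orthonormal ℝ fun j => (b j : EuclideanSpace ℝ (Fin n)) :=
    b.orthonormal.comp_linearIsometry Wᗮ.subtypeₗᵢ
  have hinner : ∀ x y : EuclideanSpace ℝ (Fin n),
      inner ℝ x y = WithLp.ofLp x ⬝ᵥ WithLp.ofLp y := fun x y => by
    simp [PiLp.inner_apply, dotProduct, mul_comm]
  refine ⟨_, fun j => WithLp.ofLp (b j : EuclideanSpace ℝ (Fin n)), by omega, ?_, ?_, ?_⟩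
  · intro j k
    rw [← hinner]
    exact orthonormal_iff_ite.1 hb j k
  · intro j
    ext k
    have h := (Submodule.mem_orthogonal' W _).1 (b j).2 _ (Submodule.subset_span ⟨k, rfl⟩)
    rw [hinner] at h
    exact h
  · intro c
    have h := hb.sum_inner_products_le (WithLp.toLp 2 c) (s := Finset.univ)
    rw [← real_inner_self_eq_norm_sq, hinner] at h
    simpa [hinner] using h

theorem sum_sign_exp {m : ℕ} (a : Fin m → ℝ) :
    ∑ s : Fin m → Bool, Real.exp (∑ j, (if s j then 1 else -1) * a j)
      = ∏ j, (2 * Real.cosh (a j)) := by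
  have h : ∀ j, 2 * Real.cosh (a j) = ∑ b : Bool, Real.exp ((if b then 1 else -1) * a j) := by
    intro j
    rw [Real.cosh_eq]
    simp
    ring
  simp_rw [h, Fintype.prod_sum, Real.exp_sum]

/-- The exponential integral `∫ exp (⟨y, A X⟩ / v) dA` over the orthogonal group. -/
noncomputable def orthExpIntegral {n p : ℕ} (v : ℝ) (y X : Matrix (Fin n) (Fin p) ℝ) : ℝ≥0∞ :=
  ∫⁻ A : OrthGroup n, ENNReal.ofReal
    (Real.exp ((y.transpose * ((A : Matrix (Fin n) (Fin n) ℝ) * X)).trace / v)) ∂uniformOrth n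

theorem sqNorm_sub {n p : ℕ} (X Y : Matrix (Fin n) (Fin p) ℝ) :
    sqNorm (X - Y) = sqNorm X + sqNorm Y - 2 * (X.transpose * Y).trace := by
  have h : (Y.transpose * X).trace = (X.transpose * Y).trace := by
    rw [← Matrix.trace_transpose, Matrix.transpose_mul, Matrix.transpose_transpose]
  rw [sqNorm_eq_trace, sqNorm_eq_trace, sqNorm_eq_trace, Matrix.transpose_sub, Matrix.sub_mul,
    Matrix.mul_sub, Matrix.mul_sub]
  simp only [Matrix.trace_sub, h]
  ring

theorem lawPDF_eq {n p : ℕ} {σ : ℝ} (hσ : σ ≠ 0) (X y : Matrix (Fin n) (Fin p) ℝ) :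
    lawPDF σ X y = ENNReal.ofReal ((√(2 * Real.pi * σ ^ 2))⁻¹ ^ (n * p) *
        Real.exp (-(sqNorm y + sqNorm X) / (2 * σ ^ 2))) * orthExpIntegral (σ ^ 2) y X := by
  rw [orthExpIntegral, ← lintegral_const_mul' _ _ ENNReal.ofReal_ne_top]
  refine lintegral_congr fun A => ?_
  rw [gaussianMatrixPDF, ← ENNReal.ofReal_mul (by positivity),
    mul_assoc (_ ^ (n * p)), ← Real.exp_add,
    sqNorm_sub, sqNorm_orth_mul]
  congr 3
  field_simp
  ring

theorem orthExpIntegral_eq_of_orth {n p : ℕ} (v : ℝ) (y X : Matrix (Fin n) (Fin p) ℝ)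
    (Q : OrthGroup n) :
    orthExpIntegral v y ((Q : Matrix (Fin n) (Fin n) ℝ) * X) = orthExpIntegral v y X := by
  unfold orthExpIntegral
  conv_rhs => rw [← lintegral_mul_right_eq_self _ Q]
  refine lintegral_congr fun A => ?_
  rw [← Matrix.mul_assoc (A : Matrix (Fin n) (Fin n) ℝ)]
  rfl

open Matrix in
theorem two_pow_mul_orthExpIntegral {n p m : ℕ} (hm : 0 < m) (v : ℝ)
    (y M : Matrix (Fin n) (Fin p) ℝ) (e : Fin n → ℝ) (x : Fin p → ℝ) (f : Fin m → Fin n → ℝ)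
    (he : e ⬝ᵥ e = 1) (heM : e ᵥ* M = 0)
    (hf : ∀ j k, f j ⬝ᵥ f k = if j = k then 1 else 0) (hfM : ∀ j, f j ᵥ* M = 0) :
    2 ^ m * orthExpIntegral v y (M + vecMulVec e x) =
      ∫⁻ A : OrthGroup n, ENNReal.ofReal
        (Real.exp ((yᵀ * ((A : Matrix (Fin n) (Fin n) ℝ) * M)).trace / v) *
          ∏ j, (2 * Real.cosh ((√m)⁻¹ *
            (f j ⬝ᵥ ((A : Matrix (Fin n) (Fin n) ℝ)ᵀ *ᵥ (y *ᵥ x))) / v)))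
        ∂uniformOrth n := by
  have hm' : (0 : ℝ) < m := by exact_mod_cast hm
  let c : (Fin m → Bool) → Fin m → ℝ := fun s j => if s j then 1 else -1
  have hc : ∀ s j, c s j * c s j = 1 := fun s j => by simp only [c]; split_ifs <;> norm_num
  -- Spreading the unit vector evenly over all `m` directions is what later produces the factor `1 /
  -- m` in the exponent.
  let u : (Fin m → Bool) → Fin n → ℝ := fun s => (√m)⁻¹ • ∑ j, c s j • f j
  have hu : ∀ s, u s ⬝ᵥ u s = 1 := fun s => by
    have h : (∑ j, c s j • f j) ⬝ᵥ (∑ j, c s j • f j) = m := by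
      simp [sum_dotProduct, dotProduct_sum, smul_dotProduct, dotProduct_smul, hf, hc]
    rw [smul_dotProduct, dotProduct_smul, h, smul_eq_mul, smul_eq_mul, ← mul_assoc, ← mul_inv,
      Real.mul_self_sqrt hm'.le, inv_mul_cancel₀ hm'.ne']
  have huM : ∀ s, u s ᵥ* M = 0 := fun s => by
    simp only [u, smul_vecMul, sum_vecMul, hfM, smul_zero, Finset.sum_const_zero]
  have hs : ∀ s : Fin m → Bool, orthExpIntegral v y (M + vecMulVec e x) = ∫⁻ A : OrthGroup n, ENNReal.ofReal
      (Real.exp ((yᵀ * ((A : Matrix (Fin n) (Fin n) ℝ) * M)).trace / v) *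
        Real.exp (∑ j, (if s j then 1 else -1) * ((√m)⁻¹ *
            (f j ⬝ᵥ ((A : Matrix (Fin n) (Fin n) ℝ)ᵀ *ᵥ (y *ᵥ x))) / v))) ∂uniformOrth n := by
    intro s
    obtain ⟨Q, hQM, hQe⟩ := exists_orth_map_vector M e (u s) (he.trans (hu s).symm) heM (huM s)
    rw [← orthExpIntegral_eq_of_orth v y _ Q, Matrix.mul_add, hQM, mul_vecMulVec, hQe]
    refine lintegral_congr fun A => ?_
    rw [← Real.exp_add, Matrix.mul_add, Matrix.mul_add, trace_add, add_div]
    congr 3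
    rw [mul_vecMulVec, mul_vecMulVec, trace_vecMulVec]
    have h1 : yᵀ *ᵥ ((A : Matrix (Fin n) (Fin n) ℝ) *ᵥ u s) ⬝ᵥ x
        = u s ⬝ᵥ ((A : Matrix (Fin n) (Fin n) ℝ)ᵀ *ᵥ (y *ᵥ x)) := by
      rw [mulVec_transpose, ← dotProduct_mulVec, dotProduct_comm, dotProduct_mulVec,
        ← mulVec_transpose, dotProduct_comm]
    rw [h1]
    simp only [u, smul_dotProduct, sum_dotProduct, smul_eq_mul, Finset.mul_sum, Finset.sum_div]
    refine Finset.sum_congr rfl fun j _ => ?_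
    simp only [c]
    ring
  have hcard : (2 : ℝ≥0∞) ^ m * orthExpIntegral v y (M + vecMulVec e x)
      = ∑ _s : Fin m → Bool, orthExpIntegral v y (M + vecMulVec e x) := by
    simp [Finset.sum_const, nsmul_eq_mul]
  rw [hcard, Finset.sum_congr rfl fun s _ => hs s, ← lintegral_finsetSum]
  · refine lintegral_congr fun A => ?_
    rw [← ENNReal.ofReal_sum_of_nonneg fun _ _ => by positivity, ← Finset.mul_sum, sum_sign_exp]
  · intro s _
    refine (ENNReal.continuous_ofReal.comp ?_).measurable
    have : Continuous fun A : OrthGroup n => (A : Matrix (Fin n) (Fin n) ℝ) :=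
      continuous_subtype_val
    fun_prop

open Matrix in
theorem dotProduct_mulVec_self_le {n p : ℕ} (y : Matrix (Fin n) (Fin p) ℝ) (x : Fin p → ℝ) :
    (y *ᵥ x) ⬝ᵥ (y *ᵥ x) ≤ sqNorm y * (x ⬝ᵥ x) := by
  rw [sqNorm, Finset.sum_mul]
  refine Finset.sum_le_sum fun i _ => ?_
  simp only [mulVec, dotProduct, ← sq]
  exact Finset.sum_mul_sq_le_sq_mul_sq _ _ _

open Matrix in
theorem orthExpIntegral_row_bounds {n p : ℕ} (hnp : p < n) {v : ℝ} (hv : 0 < v)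
    (y M : Matrix (Fin n) (Fin p) ℝ) (e : Fin n → ℝ) (x : Fin p → ℝ)
    (he : e ⬝ᵥ e = 1) (heM : e ᵥ* M = 0) :
    orthExpIntegral v y M ≤ orthExpIntegral v y (M + vecMulVec e x) ∧
      orthExpIntegral v y (M + vecMulVec e x) ≤ ENNReal.ofReal
        (Real.exp (sqNorm y * (x ⬝ᵥ x) / (2 * v ^ 2 * (n - p)))) * orthExpIntegral v y M := by
  obtain ⟨m, f, hmp, hf, hfM, hbessel⟩ := exists_orthonormal_vecMul_eq_zero M
  have hm : 0 < m := by omega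
  have hm' : (0 : ℝ) < m := by exact_mod_cast hm
  have hmp' : (n : ℝ) - p ≤ m := by
    have : (n : ℝ) ≤ m + p := by exact_mod_cast hmp
    linarith
  have hnp' : (0 : ℝ) < n - p := sub_pos.2 (by exact_mod_cast hnp)
  have key := two_pow_mul_orthExpIntegral hm v y M e x f he heM hf hfM
  have h2 : (2 : ℝ≥0∞) ^ m ≠ 0 := by positivity
  have h2' : (2 : ℝ≥0∞) ^ m ≠ ⊤ := by finiteness
  have h2r : (2 : ℝ≥0∞) ^ m = ENNReal.ofReal (2 ^ m) := by
    rw [ENNReal.ofReal_pow (by norm_num)]; norm_num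
  have hprod : ∀ a : Fin m → ℝ, ∏ j, (2 * Real.cosh (a j)) = 2 ^ m * ∏ j, Real.cosh (a j) :=
    fun a => by simp [Finset.prod_mul_distrib]
  constructor
  · rw [← ENNReal.mul_le_mul_iff_right h2 h2', key, h2r, orthExpIntegral,
      ← lintegral_const_mul' _ _ ENNReal.ofReal_ne_top]
    refine lintegral_mono fun A => ?_
    rw [← ENNReal.ofReal_mul (by positivity), mul_comm]
    refine ENNReal.ofReal_le_ofReal (mul_le_mul_of_nonneg_left ?_ (Real.exp_nonneg _))
    rw [hprod]
    exact le_mul_of_one_le_right (by positivity)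
      (Finset.one_le_prod fun j _ => Real.one_le_cosh _)
  · rw [← ENNReal.mul_le_mul_iff_right h2 h2', key, h2r, orthExpIntegral,
      ← lintegral_const_mul' _ _ ENNReal.ofReal_ne_top,
      ← lintegral_const_mul' _ _ ENNReal.ofReal_ne_top]
    refine lintegral_mono fun A => ?_
    rw [← ENNReal.ofReal_mul (by positivity), ← ENNReal.ofReal_mul (by positivity), hprod]
    refine ENNReal.ofReal_le_ofReal ?_
    rw [mul_left_comm]
    refine mul_le_mul_of_nonneg_left ?_ (by positivity)
    rw [mul_comm]
    refine mul_le_mul_of_nonneg_right ?_ (Real.exp_nonneg _)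
    set b := (A : Matrix (Fin n) (Fin n) ℝ)ᵀ *ᵥ (y *ᵥ x) with hb
    have hbb : b ⬝ᵥ b = (y *ᵥ x) ⬝ᵥ (y *ᵥ x) := by
      rw [hb, dotProduct_mulVec, vecMul_transpose, mulVec_mulVec, A.mul_transpose, one_mulVec]
    -- The exponents add up to a Bessel sum, bounded by `b ⬝ᵥ b`, the squared length of `y *ᵥ x`;
    -- then Cauchy–Schwarz and `m ≥ n - p` apply.
    calc ∏ j, Real.cosh ((√m)⁻¹ * (f j ⬝ᵥ b) / v)
        ≤ ∏ j, Real.exp (((√m)⁻¹ * (f j ⬝ᵥ b) / v) ^ 2 / 2) :=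
          Finset.prod_le_prod (fun _ _ => (Real.cosh_pos _).le)
            fun _ _ => Real.cosh_le_exp_half_sq _
      _ = Real.exp ((∑ j, (f j ⬝ᵥ b) ^ 2) / (2 * v ^ 2 * m)) := by
          rw [← Real.exp_sum, Finset.sum_div]
          congr 1
          refine Finset.sum_congr rfl fun j _ => ?_
          rw [div_pow, mul_pow, inv_pow, Real.sq_sqrt hm'.le]
          field_simp
      _ ≤ Real.exp (sqNorm y * (x ⬝ᵥ x) / (2 * v ^ 2 * (n - p))) := by
          have h3 := (hbessel b).trans (hbb.le.trans (dotProduct_mulVec_self_le y x))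
          have h4 : 0 ≤ ∑ j, (f j ⬝ᵥ b) ^ 2 := Finset.sum_nonneg fun _ _ => sq_nonneg _
          gcongr
          linarith

/-! ### The exceptional event and the density ratio. -/

theorem sqNorm_add_le {n p : ℕ} (X C : Matrix (Fin n) (Fin p) ℝ) :
    sqNorm (X + C) ≤ 2 * sqNorm X + 2 * sqNorm C := by
  simp only [sqNorm, Finset.mul_sum, ← Finset.sum_add_distrib]
  refine Finset.sum_le_sum fun i _ => Finset.sum_le_sum fun j _ => ?_
  rw [Matrix.add_apply]
  nlinarith [sq_nonneg (X i j - C i j)]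

theorem IsData.sq_le_one {n p : ℕ} {X : Matrix (Fin n) (Fin p) ℝ} (hX : IsData X) (i : Fin n)
    (j : Fin p) : X i j ^ 2 ≤ 1 :=
  (sq_le_one_iff_abs_le_one _).2 (hX i j)

theorem IsData.dotProduct_row_le {n p : ℕ} {X : Matrix (Fin n) (Fin p) ℝ} (hX : IsData X)
    (i : Fin n) : dotProduct (X i) (X i) ≤ p := by
  simpa [dotProduct, ← sq] using Finset.sum_le_sum fun j (_ : j ∈ Finset.univ) => hX.sq_le_one i j

theorem IsData.sqNorm_le {n p : ℕ} {X : Matrix (Fin n) (Fin p) ℝ} (hX : IsData X) :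
    sqNorm X ≤ n * p := by
  have h := Finset.sum_le_sum fun i (_ : i ∈ Finset.univ) => hX.dotProduct_row_le i
  simpa [sqNorm, dotProduct, ← sq] using h

/-- In form (B) the mask drops out of the norm, leaving `‖X + C‖² ≤ 2‖X‖² + 2‖C‖²` with `‖X‖² ≤ np`.
-/
theorem lawB_sqNorm_gt_le (n p : ℕ) {σ δ : ℝ} (hσ : σ ≠ 0) (hδ : 0 < δ)
    {X : Matrix (Fin n) (Fin p) ℝ} (hX : IsData X) :
    lawB n p σ X {y | 2 * (n * p) + 2 * (σ ^ 2 * chiSquareUpperQuantile (n * p) δ) < sqNorm y}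
      ≤ ENNReal.ofReal δ := by
  refine le_trans ?_ (chiSquare_Ioi_upperQuantile_le (n * p) hδ)
  rw [lawB, Measure.map_apply (measurable_maskB X)
    (measurableSet_lt measurable_const measurable_sqNorm), ← gaussianMatrix_sqNorm_gt n p hσ]
  calc _ ≤ ((uniformOrth n).prod (gaussianMatrix n p σ)) (Set.univ ×ˢ
        {c | σ ^ 2 * chiSquareUpperQuantile (n * p) δ < sqNorm c}) := by
        refine measure_mono fun ω hω => ⟨trivial, ?_⟩
        simp only [Set.mem_preimage, Set.mem_ofPred_eq, sqNorm_orth_mul] at hω ⊢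
        linarith [sqNorm_add_le X ω.2, hX.sqNorm_le]
    _ = _ := by rw [Measure.prod_prod, measure_univ, one_mul]

-- Compare both integrals with that of the common part `M`: the upper row bound serves `X`, the
-- lower one `X'`. The first exponent term pays for the change in the Gaussian prefactor.
open Matrix in
theorem lawPDF_le_of_row {n p : ℕ} (hnp : p < n) {σ : ℝ} (hσ : σ ≠ 0)
    {X X' : Matrix (Fin n) (Fin p) ℝ} {i : Fin n} (h : ∀ k, k ≠ i → ∀ j, X k j = X' k j)
    (y : Matrix (Fin n) (Fin p) ℝ) :
    lawPDF σ X y ≤ ENNReal.ofReal (Real.exp (X' i ⬝ᵥ X' i / (2 * σ ^ 2) +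
      sqNorm y * (X i ⬝ᵥ X i) / (2 * (σ ^ 2) ^ 2 * (n - p)))) * lawPDF σ X' y := by
  set M : Matrix (Fin n) (Fin p) ℝ := X.updateRow i 0 with hM
  have hX : X = M + vecMulVec (Pi.single i 1) (X i) := by
    ext k j
    by_cases hk : k = i
    · subst hk; simp [hM, vecMulVec_apply]
    · simp [hM, vecMulVec_apply, hk]
  have hX' : X' = M + vecMulVec (Pi.single i 1) (X' i) := by
    ext k j
    by_cases hk : k = i
    · subst hk; simp [hM, vecMulVec_apply]
    · simp [hM, vecMulVec_apply, hk, h k hk j]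
  have he : (Pi.single i 1 : Fin n → ℝ) ⬝ᵥ Pi.single i 1 = 1 := by simp
  have heM : (Pi.single i 1 : Fin n → ℝ) ᵥ* M = 0 := by
    ext j
    simp [hM]
  have hσ2 : 0 < σ ^ 2 := by positivity
  have hnorm : sqNorm X' ≤ sqNorm X + X' i ⬝ᵥ X' i := by
    have hrow : ∀ k, ∑ j, X' k j ^ 2 ≤ ∑ j, X k j ^ 2 + if k = i then X' i ⬝ᵥ X' i else 0 := by
      intro k
      by_cases hk : k = i
      · subst hk
        simp only [if_true, dotProduct, ← sq]
        have : 0 ≤ ∑ j, X k j ^ 2 := Finset.sum_nonneg fun _ _ => sq_nonneg _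
        linarith
      · simp [hk, h k hk]
    calc sqNorm X' ≤ ∑ k, (∑ j, X k j ^ 2 + if k = i then X' i ⬝ᵥ X' i else 0) :=
          Finset.sum_le_sum fun k _ => hrow k
      _ = _ := by simp [Finset.sum_add_distrib, sqNorm]
  have hub := (orthExpIntegral_row_bounds hnp hσ2 y M _ (X i) he heM).2
  have hlb := (orthExpIntegral_row_bounds hnp hσ2 y M _ (X' i) he heM).1
  rw [← hX] at hub
  rw [← hX'] at hlb
  have hub' := hub.trans (mul_le_mul_right hlb _)
  rw [lawPDF_eq hσ, lawPDF_eq hσ, ← mul_assoc, ← ENNReal.ofReal_mul (by positivity)]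
  refine (mul_le_mul_right hub' _).trans ?_
  rw [← mul_assoc, ← ENNReal.ofReal_mul (by positivity)]
  refine mul_le_mul_left (ENNReal.ofReal_le_ofReal ?_) _
  rw [mul_left_comm, mul_assoc]
  refine mul_le_mul_of_nonneg_left ?_ (by positivity)
  rw [← Real.exp_add, ← Real.exp_add, Real.exp_le_exp]
  have hd : -(sqNorm y + sqNorm X) / (2 * σ ^ 2)
      ≤ X' i ⬝ᵥ X' i / (2 * σ ^ 2) + -(sqNorm y + sqNorm X') / (2 * σ ^ 2) := by
    rw [← add_div]
    gcongr
    linarith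
  linarith

/-- With `s = σ²` the two terms are at most `ε/8` and `3ε/8`. In the second, the `np` part of `r`
contributes `ε/8`, using `s ≥ 2`, and the `γ` part contributes `ε/4`. -/
theorem exponent_le {n p : ℕ} (hnp : p < n) {ε s γ r a b : ℝ} (hε : 0 < ε) (hs2 : 2 ≤ s)
    (hs : 4 * (n : ℝ) * (p : ℝ) ^ 2 / (((n : ℝ) - p) * ε) ≤ s)
    (hsγ : 4 * (p : ℝ) * γ / (((n : ℝ) - p) * ε) ≤ s) (hγ : 0 ≤ γ)
    (hr : r ≤ 2 * (n * p) + 2 * (s * γ)) (ha : a ≤ p) (hb0 : 0 ≤ b) (hb : b ≤ p) :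
    a / (2 * s) + r * b / (2 * s ^ 2 * (n - p)) ≤ ε := by
  have hd : (0 : ℝ) < n - p := sub_pos.2 (by exact_mod_cast hnp)
  have hs0 : 0 < s := by linarith
  rw [div_le_iff₀ (by positivity)] at hs hsγ
  have hp2 : (p : ℝ) ≤ (p : ℝ) ^ 2 := by exact_mod_cast Nat.le_self_pow two_ne_zero p
  have h1 : (p : ℝ) * 4 ≤ s * ε := by
    have h : ((n : ℝ) - p) * (p * 4) ≤ (n - p) * (s * ε) := by
      have hp0 : (0 : ℝ) ≤ p := p.cast_nonneg
      have hn0 : (0 : ℝ) ≤ n := n.cast_nonneg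
      nlinarith [mul_le_mul_of_nonneg_left hp2 hn0, mul_nonneg hp0 hp0]
    exact le_of_mul_le_mul_left h hd
  have ha' : a / (2 * s) ≤ ε / 8 := by
    rw [div_le_iff₀ (by positivity)]
    linarith
  have hrb : r * b ≤ (2 * (n * p) + 2 * (s * γ)) * p :=
    (mul_le_mul_of_nonneg_right hr hb0).trans (mul_le_mul_of_nonneg_left hb (by positivity))
  have hb' : r * b / (2 * s ^ 2 * (n - p)) ≤ 3 / 8 * ε := by
    rw [div_le_iff₀ (by positivity)]
    have h3 : 4 * (p : ℝ) * γ * s ≤ s * ((n - p) * ε) * s := mul_le_mul_of_nonneg_right hsγ hs0.le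
    have h4 : s * (((n : ℝ) - p) * ε) * 2 ≤ s * ((n - p) * ε) * s :=
      mul_le_mul_of_nonneg_left hs2 (by positivity)
    nlinarith
  linarith

theorem lawC_absolutelyContinuous (n p : ℕ) {σ : ℝ} (hσ : σ ≠ 0)
    (X : Matrix (Fin n) (Fin p) ℝ) : lawC n p σ X ≪ volume := by
  rw [lawC_eq_withDensity n p hσ X]
  exact withDensity_absolutelyContinuous _ _

theorem density_lawC (n p : ℕ) {σ : ℝ} (hσ : σ ≠ 0) (X : Matrix (Fin n) (Fin p) ℝ) :
    density (lawC n p σ X) =ᵐ[volume] lawPDF σ X := by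
  rw [density, lawC_eq_withDensity n p hσ X]
  exact Measure.rnDeriv_withDensity _ (measurable_lawPDF σ X)

theorem densitySetCondition_lawC (n p : ℕ) (hnp : p < n) (ε δ σ : ℝ) (hε : 0 < ε) (hδ : 0 < δ)
    (hσ : max 2 (max (4 * (n : ℝ) * (p : ℝ) ^ 2 / (((n : ℝ) - (p : ℝ)) * ε))
        (4 * (p : ℝ) * chiSquareUpperQuantile (n * p) δ / (((n : ℝ) - (p : ℝ)) * ε))) ≤ σ ^ 2) :
    DensitySetCondition (lawC n p σ) ε δ := by
  obtain ⟨h2, hrest⟩ := max_le_iff.1 hσ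
  obtain ⟨hs, hsγ⟩ := max_le_iff.1 hrest
  have hσ0 : σ ≠ 0 := by rintro rfl; norm_num at h2
  refine ⟨fun X _ => lawC_absolutelyContinuous n p hσ0 X, ?_⟩
  rintro X X' hX hX' ⟨⟨i, hi⟩, -⟩
  refine le_trans ?_ (lawB_eq_lawC n p hσ0 X ▸ lawB_sqNorm_gt_le n p hσ0 hδ hX)
  -- The densities are known only almost everywhere, so the density set lies in the large-norm event
  -- only up to a null set.
  refine measure_mono_ae ?_
  filter_upwards [(lawC_absolutelyContinuous n p hσ0 X).ae_le (density_lawC n p hσ0 X),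
    (lawC_absolutelyContinuous n p hσ0 X).ae_le (density_lawC n p hσ0 X')] with y hy hy' hmem
  by_contra hle
  replace hle : sqNorm y ≤ _ := not_lt.1 hle
  refine absurd hmem (not_lt.2 ?_)
  rw [hy, hy']
  refine (lawPDF_le_of_row hnp hσ0 hi y).trans (mul_le_mul_left (ENNReal.ofReal_le_ofReal ?_) _)
  exact Real.exp_le_exp.2 (exponent_le hnp hε h2 hs hsγ (chiSquareUpperQuantile_nonneg _ _) hle
    (hX'.dotProduct_row_le i) (Finset.sum_nonneg fun _ _ => mul_self_nonneg _)
    (hX.dotProduct_row_le i))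

end MatrixMasking

theorem mainTheorem6 (n p : ℕ) (hnp : p < n) (ε δ σ : ℝ) (hε : 0 < ε) (hε1 : ε < 1) (hδ : 0 < δ)
    (hσ : max 2 (max (4 * (n : ℝ) * (p : ℝ) ^ 2 / (((n : ℝ) - (p : ℝ)) * ε))
        (4 * (p : ℝ) * MatrixMasking.chiSquareUpperQuantile (n * p) δ /
          (((n : ℝ) - (p : ℝ)) * ε))) ≤ σ ^ 2) :
    MatrixMasking.DensitySetCondition (MatrixMasking.lawB n p σ) ε δ ∧
      MatrixMasking.DensitySetCondition (MatrixMasking.lawC n p σ) ε δ := by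
  have hC := MatrixMasking.densitySetCondition_lawC n p hnp ε δ σ hε hδ hσ
  have hσ0 : σ ≠ 0 := by
    rintro rfl
    have h2 := (max_le_iff.1 hσ).1
    norm_num at h2
  have h : MatrixMasking.lawB n p σ = MatrixMasking.lawC n p σ :=
    funext fun X => MatrixMasking.lawB_eq_lawC n p hσ0 X
  exact ⟨h ▸ hC, hC⟩
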